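/- Let $n$ be a natural number and let $A_0,A_1,A_2,A_3\in\mathbb{C}^{n\times n}$ be Hermitian matrices. Property $\mathcal{IC}$ is said to hold for $A_0,A_1,A_2,A_3$ if there exist real numbers $\mu_1,\mu_2,\mu_3,\mu_4>0$ and vectors $x_1,x_2\in\mathbb{C}^n$ such that - (IC.1) $Z:=A_0+\mu_1A_1+\mu_2A_2+\mu_3A_3+\mu_4I_n\succeq0$ and $\operatorname{span}_{\mathbb{C}}\{x_1,x_2\}=\operatorname{Null}(Z)$; - (IC.2) $x_1^HA_1x_1=x_2^HA_1x_2=0$ and $\operatorname{Re}(x_1^HA_1x_2)\neq0$; - (IC.3) $x_1^HA_2x_1=x_2^HA_2x_2=0$, $\operatorname{Re}(x_1^HA_2x_2)=0$ and $\operatorname{Im}(x_1^HA_2x_2)\neq0$; - (IC.4) $x_1^HA_3x_1<0<x_2^HA_3x_2$. Theorem (complex S-lemma for four Hermitian forms). Let $A_0,A_1,A_2,A_3$ be $n\times n$ Hermitian matrices, and assume that there is a vector $x_0\in\mathbb{C}^n$ with $x_0^HA_kx_0<0$ for $k=1,2,3$. Then the following two statements are equivalent. (i) There is no $x\in\mathbb{C}^n$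 with $x^HA_0x<0$ and $x^HA_kx\le0$ for $k=1,2,3$, and Property $\mathcal{IC}$ fails for $A_0,A_1,A_2,A_3$. (ii) There exist real numbers $\mu_1,\mu_2,\mu_3\ge0$ such that $A_0+\mu_1A_1+\mu_2A_2+\mu_3A_3\succeq0$. Here $\succeq0$ means Hermitian positive semidefinite. -/

import Mathlib

open scoped ComplexOrder Matrix

/-- The complex number `xᴴ A y`. -/
def sesq {n : ℕ} (A : Matrix (Fin n) (Fin n) ℂ) (x y : Fin n → ℂ) : ℂ :=
  star x ⬝ᵥ (A *ᵥ y)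

/-- The real value of the form `xᴴ A x` of a Hermitian matrix `A`
(the imaginary part vanishes, see `ofReal_hermForm`). -/
def hermForm {n : ℕ} (A : Matrix (Fin n) (Fin n) ℂ) (x : Fin n → ℂ) : ℝ :=
  (sesq A x x).re

theorem ofReal_hermForm {n : ℕ} {A : Matrix (Fin n) (Fin n) ℂ} (hA : A.IsHermitian)
    (x : Fin n → ℂ) : ((hermForm A x : ℝ) : ℂ) = sesq A x x := by
  apply Complex.ext
  · simp [hermForm]
  · have h := hA.im_star_dotProduct_mulVec_self x
    simpa [sesq] using h.symm

/-- Property `IC` for `A₀, A₁, A₂, A₃`: there are positive multipliers `μ₁, …, μ₄` such that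
`Z = A₀ + μ₁ A₁ + μ₂ A₂ + μ₃ A₃ + μ₄ I` is positive semidefinite, and vectors `x₁, x₂` spanning
the null space of `Z` on which `A₁, A₂, A₃` take the prescribed shape. -/
def PropertyIC {n : ℕ} (A₀ A₁ A₂ A₃ : Matrix (Fin n) (Fin n) ℂ) : Prop :=
  ∃ (μ₁ μ₂ μ₃ μ₄ : ℝ) (x₁ x₂ : Fin n → ℂ),
    (0 < μ₁ ∧ 0 < μ₂ ∧ 0 < μ₃ ∧ 0 < μ₄) ∧
    ((A₀ + μ₁ • A₁ + μ₂ • A₂ + μ₃ • A₃ + μ₄ • (1 : Matrix (Fin n) (Fin n) ℂ)).PosSemidef ∧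
      Submodule.span ℂ {x₁, x₂} = LinearMap.ker (Matrix.mulVecLin
        (A₀ + μ₁ • A₁ + μ₂ • A₂ + μ₃ • A₃ + μ₄ • (1 : Matrix (Fin n) (Fin n) ℂ)))) ∧
    (sesq A₁ x₁ x₁ = 0 ∧ sesq A₁ x₂ x₂ = 0 ∧ (sesq A₁ x₁ x₂).re ≠ 0) ∧
    (sesq A₂ x₁ x₁ = 0 ∧ sesq A₂ x₂ x₂ = 0 ∧
      (sesq A₂ x₁ x₂).re = 0 ∧ (sesq A₂ x₁ x₂).im ≠ 0) ∧
    (hermForm A₃ x₁ < 0 ∧ 0 < hermForm A₃ x₂)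

/-!
Multipliers clearly exclude the vectors `x` of the first condition; that they exclude `PropertyIC` is
`not_propertyIC_of_posSemidef`.

For the converse, let `S ⊆ ℝ⁴` be the convex hull of the joint values `(A₀, A₁, A₂, A₃)(x)` at unit
vectors `x`. Minimising the first coordinate over `S` subject to the other three being nonpositive
is the semidefinite relaxation of the problem. The hull is compact and `x₀` is a Slater point, so
there are a minimiser `c` and multipliers `μ ≥ 0` with `A₀ + ∑ μₖ Aₖ ⪰ c₀ I`
(`exists_minimizer_multipliers`). If `c₀ ≥ 0` this is the certificate sought. If `c₀ < 0`, put
`Z = A₀ + ∑ μₖ Aₖ - c₀ I ⪰ 0`; by complementary slackness `μₖ cₖ = 0`, and `c` is a convex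
combination of values at unit vectors of `W = Null Z`. A nonzero `x ∈ W` with `Aₖ(x) ≤ 0` and
`μₖ Aₖ(x) = 0` for all `k` would give `A₀(x) < 0`; such `x` are forbidden.

The joint range of three forms on `W` need not be convex, but it becomes so when filled in one
coordinate direction (`convex_filled_range`; on a plane the unfilled range is an ellipsoid, the image
of the Bloch sphere). If some `μₖ = 0`, filling in direction `k` yields the forbidden `x`. If all
`μₖ > 0`, then `cₖ = 0`, and filling upwards and downwards gives `x₁, x₂ ∈ W` at which `A₁, A₂`
vanish and `A₃` is negative, respectively positive. Were `x₁` and `x₂` joined by a path in the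
common projective zero set of `A₁` and `A₂` within `W`, the intermediate value theorem would give the
forbidden `x`. When the off-diagonal entries `x₁ᴴA₁x₂` and `x₁ᴴA₂x₂` are linearly dependent over `ℝ`,
a segment does this after a change of phase. When they are independent and `W` contains a third
independent vector, an explicit polynomial path does (`exists_zero_of_three`); this amounts to the
fact that the map `ℂP¹ → S²` defined by three independent forms does not extend to `ℂP²`. The
remaining configuration, in which `x₁` and `x₂` span `W`, is `PropertyIC`
(`exists_span_of_no_common_zero`).
-/

/-! ### Algebra of the sesquilinear forms -/

section Algebra

variable {n : ℕ}

theorem sesq_add_left (A : Matrix (Fin n) (Fin n) ℂ) (x y z : Fin n → ℂ) :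
    sesq A (x + y) z = sesq A x z + sesq A y z := by
  simp [sesq, add_dotProduct]

theorem sesq_add_right (A : Matrix (Fin n) (Fin n) ℂ) (x y z : Fin n → ℂ) :
    sesq A x (y + z) = sesq A x y + sesq A x z := by
  simp [sesq, Matrix.mulVec_add, dotProduct_add]

theorem sesq_smul_left (A : Matrix (Fin n) (Fin n) ℂ) (c : ℂ) (x y : Fin n → ℂ) :
    sesq A (c • x) y = star c * sesq A x y := by
  simp [sesq, smul_dotProduct]

theorem sesq_smul_right (A : Matrix (Fin n) (Fin n) ℂ) (c : ℂ) (x y : Fin n → ℂ) :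
    sesq A x (c • y) = c * sesq A x y := by
  simp [sesq, Matrix.mulVec_smul, dotProduct_smul]

theorem sesq_add_mat (A B : Matrix (Fin n) (Fin n) ℂ) (x y : Fin n → ℂ) :
    sesq (A + B) x y = sesq A x y + sesq B x y := by
  simp [sesq, Matrix.add_mulVec, dotProduct_add]

theorem sesq_smul_mat (c : ℂ) (A : Matrix (Fin n) (Fin n) ℂ) (x y : Fin n → ℂ) :
    sesq (c • A) x y = c * sesq A x y := by
  simp [sesq, Matrix.smul_mulVec, dotProduct_smul]

theorem sesq_conjTranspose (A : Matrix (Fin n) (Fin n) ℂ) (x y : Fin n → ℂ) :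
    sesq Aᴴ x y = star (sesq A y x) := by
  rw [sesq, sesq, Matrix.star_dotProduct, Matrix.star_mulVec, Matrix.conjTranspose_conjTranspose,
    Matrix.dotProduct_mulVec]

theorem Matrix.IsHermitian.sesq_comm {A : Matrix (Fin n) (Fin n) ℂ} (hA : A.IsHermitian)
    (x y : Fin n → ℂ) : sesq A y x = star (sesq A x y) := by
  rw [← sesq_conjTranspose, hA.eq]

theorem Matrix.IsHermitian.sesq_self_eq_zero {A : Matrix (Fin n) (Fin n) ℂ} (hA : A.IsHermitian)
    {x : Fin n → ℂ} : sesq A x x = 0 ↔ hermForm A x = 0 := by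
  rw [← ofReal_hermForm hA]; norm_cast

theorem hermForm_add_mat (A B : Matrix (Fin n) (Fin n) ℂ) (x : Fin n → ℂ) :
    hermForm (A + B) x = hermForm A x + hermForm B x := by
  simp [hermForm, sesq_add_mat]

theorem hermForm_smul_mat (r : ℝ) (A : Matrix (Fin n) (Fin n) ℂ) (x : Fin n → ℂ) :
    hermForm (r • A) x = r * hermForm A x := by
  have : r • A = (r : ℂ) • A := by ext; simp
  rw [this, hermForm, sesq_smul_mat]; simp [hermForm]

theorem hermForm_neg_mat (A : Matrix (Fin n) (Fin n) ℂ) (x : Fin n → ℂ) :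
    hermForm (-A) x = -hermForm A x := by
  simpa using hermForm_smul_mat (-1) A x

theorem hermForm_smul (A : Matrix (Fin n) (Fin n) ℂ) (c : ℂ) (x : Fin n → ℂ) :
    hermForm A (c • x) = Complex.normSq c * hermForm A x := by
  rw [hermForm, sesq_smul_left, sesq_smul_right, ← mul_assoc, Complex.star_def,
    ← Complex.normSq_eq_conj_mul_self, Complex.re_ofReal_mul, hermForm]

theorem hermForm_zero (A : Matrix (Fin n) (Fin n) ℂ) : hermForm A 0 = 0 := by
  simp [hermForm, sesq]

theorem hermForm_smul_add_smul {A : Matrix (Fin n) (Fin n) ℂ} (hA : A.IsHermitian) (a b : ℂ)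
    (x y : Fin n → ℂ) : hermForm A (a • x + b • y) = Complex.normSq a * hermForm A x +
      Complex.normSq b * hermForm A y + 2 * (star a * b * sesq A x y).re := by
  have h : sesq A (a • x + b • y) (a • x + b • y) = sesq A (a • x) (a • x) +
      sesq A (b • y) (b • y) + (star a * b * sesq A x y + star (star a * b * sesq A x y)) := by
    simp only [sesq_add_left, sesq_add_right, sesq_smul_left, sesq_smul_right, hA.sesq_comm x y,
      star_mul', star_star]
    ring
  rw [hermForm, h]
  have h2 : (star (star a * b * sesq A x y)).re = (star a * b * sesq A x y).re := by
    rw [Complex.star_def, Complex.conj_re]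
  simp only [Complex.add_re, h2, ← hermForm_smul]
  simp only [hermForm]
  ring

theorem continuous_hermForm (A : Matrix (Fin n) (Fin n) ℂ) : Continuous (hermForm A) := by
  unfold hermForm sesq
  fun_prop

theorem hermForm_one_pos {x : Fin n → ℂ} (hx : x ≠ 0) : 0 < hermForm 1 x := by
  have := Matrix.PosDef.one (R := ℂ) (n := Fin n) |>.re_dotProduct_pos hx
  simpa [hermForm, sesq] using this

theorem posSemidef_iff_hermForm {A : Matrix (Fin n) (Fin n) ℂ} (hA : A.IsHermitian) :
    A.PosSemidef ↔ ∀ x, 0 ≤ hermForm A x := by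
  rw [Matrix.posSemidef_iff_dotProduct_mulVec]
  refine ⟨fun h x => ?_, fun h => ⟨hA, fun x => ?_⟩⟩
  · exact (Complex.le_def.1 (h.2 x)).1
  · change 0 ≤ sesq A x x
    rw [← ofReal_hermForm hA]
    exact_mod_cast h x

end Algebra

/-! ### Paths in the zero set of two forms -/

section Path

variable {n : ℕ}

/-- Intermediate value theorem for a Hermitian form along a path of nonzero vectors in the zero set
of a sesquilinear form. -/
theorem exists_zero_on_path {W : Submodule ℂ (Fin n → ℂ)} (M A : Matrix (Fin n) (Fin n) ℂ)
    {a b : ℝ} (hab : a ≤ b) (z : ℝ → Fin n → ℂ) (hz : Continuous z)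
    (hW : ∀ t ∈ Set.Icc a b, z t ∈ W)
    (hM : ∀ t ∈ Set.Icc a b, sesq M (z t) (z t) = 0)
    (h0 : ∀ t ∈ Set.Icc a b, hermForm A (z t) = 0 → z t ≠ 0)
    (ha : hermForm A (z a) ≤ 0) (hb : 0 ≤ hermForm A (z b)) :
    ∃ x ∈ W, x ≠ 0 ∧ sesq M x x = 0 ∧ hermForm A x = 0 := by
  obtain ⟨t, ht, h⟩ := intermediate_value_Icc hab
    ((continuous_hermForm A).comp hz).continuousOn ⟨ha, hb⟩
  exact ⟨z t, hW t ht, h0 t ht h, hM t ht, h⟩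

theorem exists_zero_on_segment {W : Submodule ℂ (Fin n → ℂ)} (M A : Matrix (Fin n) (Fin n) ℂ)
    {x y : Fin n → ℂ} (hx : x ∈ W) (hy : y ∈ W) (hMx : sesq M x x = 0) (hMy : sesq M y y = 0)
    (hMxy : sesq M x y + sesq M y x = 0) (hAx : hermForm A x < 0) (hAy : 0 < hermForm A y) :
    ∃ z ∈ W, z ≠ 0 ∧ sesq M z z = 0 ∧ hermForm A z = 0 := by
  refine exists_zero_on_path M A zero_le_one
    (fun t : ℝ => ((1 - t : ℝ) : ℂ) • x + (t : ℂ) • y) (by fun_prop)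
    (fun t _ => W.add_mem (W.smul_mem _ hx) (W.smul_mem _ hy)) ?_ ?_ (by simpa using hAx.le)
    (by simpa using hAy.le)
  · intro t _
    simp only [sesq_add_left, sesq_add_right, sesq_smul_left, sesq_smul_right, hMx, hMy,
      Complex.star_def, Complex.conj_ofReal]
    linear_combination ((1 - t : ℝ) : ℂ) * t * hMxy
  · intro t _ _ h
    -- the two summands cannot cancel, since `A` has opposite signs on them
    have h1 : ((1 - t : ℝ) : ℂ) • x = (-t : ℂ) • y := by
      rw [neg_smul]; exact eq_neg_of_add_eq_zero_left h
    have h2 := congrArg (hermForm A) h1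
    rw [hermForm_smul, hermForm_smul, Complex.normSq_neg, Complex.normSq_ofReal,
      Complex.normSq_ofReal] at h2
    have h3 : t = 0 := by
      by_contra ht
      nlinarith [mul_pos (mul_self_pos.2 ht) hAy, mul_self_nonneg (1 - t)]
    subst h3
    norm_num at h2
    exact hAx.ne h2

/-- Two segments in the zero set of `M`, joined at `y`. -/
theorem exists_zero_on_two_segments {W : Submodule ℂ (Fin n → ℂ)}
    (M A : Matrix (Fin n) (Fin n) ℂ) {x₁ y x₂ : Fin n → ℂ} (hx₁ : x₁ ∈ W) (hy : y ∈ W)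
    (hx₂ : x₂ ∈ W) (hy0 : y ≠ 0) (hM₁ : sesq M x₁ x₁ = 0) (hMy : sesq M y y = 0)
    (hM₂ : sesq M x₂ x₂ = 0) (hM₁y : sesq M x₁ y + sesq M y x₁ = 0)
    (hMy₂ : sesq M y x₂ + sesq M x₂ y = 0) (hA₁ : hermForm A x₁ < 0) (hA₂ : 0 < hermForm A x₂) :
    ∃ z ∈ W, z ≠ 0 ∧ sesq M z z = 0 ∧ hermForm A z = 0 := by
  rcases lt_trichotomy (hermForm A y) 0 with h | h | h
  · exact exists_zero_on_segment M A hy hx₂ hMy hM₂ hMy₂ h hA₂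
  · exact ⟨y, hy, hy0, hMy, h⟩
  · exact exists_zero_on_segment M A hx₁ hy hM₁ hMy hM₁y hA₁ h

/-- The form `M` in the coordinates `a, b, c`, after normalisation. -/
theorem sesq_comb (M : Matrix (Fin n) (Fin n) ℂ) (x₁ x₂ x₃ : Fin n → ℂ)
    (h11 : sesq M x₁ x₁ = 0) (h22 : sesq M x₂ x₂ = 0) (h12 : sesq M x₁ x₂ = 1)
    (h21 : sesq M x₂ x₁ = 0) (h32 : sesq M x₃ x₂ = 0) (h13 : sesq M x₁ x₃ = 0) (a b c : ℂ) :
    sesq M (a • x₁ + b • x₂ + c • x₃) (a • x₁ + b • x₂ + c • x₃) =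
      star a * b + sesq M x₃ x₁ * star c * a + sesq M x₂ x₃ * star b * c +
        sesq M x₃ x₃ * star c * c := by
  simp only [sesq_add_left, sesq_add_right, sesq_smul_left, sesq_smul_right, h11, h22, h12, h21,
    h32, h13]
  ring

theorem comb_ne_zero {x₁ x₂ x₃ : Fin n → ℂ} (hli : LinearIndependent ℂ ![x₁, x₂, x₃])
    {a b c : ℂ} (h : a ≠ 0 ∨ b ≠ 0 ∨ c ≠ 0) : a • x₁ + b • x₂ + c • x₃ ≠ 0 := by
  intro h0
  have := Fintype.linearIndependent_iff.1 hli ![a, b, c] (by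
    simpa [Fin.sum_univ_three] using h0)
  have h1 := this 0
  have h2 := this 1
  have h3 := this 2
  simp at h1 h2 h3
  simp_all

/-- A trigonometric polynomial on the unit circle which vanishes identically only for
`p = c = 0`. -/
theorem exists_unit_trig_ne_zero {p s c : ℂ} {r : ℝ} (hs : s ≠ 0) (hr : r ≠ 0)
    (hpc : ¬ (p = 0 ∧ c = 0)) :
    ∃ w : ℂ, star w * w = 1 ∧
      -p * w ^ 2 - c * w * r + s * star p * star w * r + s * star c * (r : ℂ) ^ 2 ≠ 0 := by
  by_contra! H
  have hI : Complex.I ^ 2 = -1 := Complex.I_sq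
  have h1 := H 1 (by simp)
  have h2 := H (-1) (by simp)
  have h3 := H Complex.I (by simp)
  have h4 := H (-Complex.I) (by simp)
  simp only [Complex.star_def, map_neg, map_one, Complex.conj_I] at h1 h2 h3 h4
  have h5 : s * (starRingEnd ℂ) c * (r : ℂ) ^ 2 = 0 := by
    linear_combination (h1 + h2 + h3 + h4) / 4 + p * hI / 2
  have hp : p = 0 := by linear_combination -(h1 + h2) / 2 + h5
  have hc : c = 0 := by simpa [hs, hr] using h5
  exact hpc ⟨hp, hc⟩

/-- Write `p = x₃ᴴMx₁`, `s = x₂ᴴMx₃`, `c = x₃ᴴMx₃`. If `p = c = 0`, two segments join `x₁` to `x₂` in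
the zero set of `M`. If `s ≠ 0`, the equation for a zero `αx₁ + βx₂ + x₃` of `M` is real-linear in
`β` with determinant `|α|² - |s|²`; along the ray `α = w / u`, clearing this determinant and the
powers of `u` gives a polynomial path from `w • x₁` to a multiple of `x₂`. -/
theorem exists_zero_of_normalized_of_ne {W : Submodule ℂ (Fin n → ℂ)}
    (M A : Matrix (Fin n) (Fin n) ℂ) {x₁ x₂ x₃ : Fin n → ℂ} (hx₁ : x₁ ∈ W) (hx₂ : x₂ ∈ W)
    (hx₃ : x₃ ∈ W) (hli : LinearIndependent ℂ ![x₁, x₂, x₃])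
    (h11 : sesq M x₁ x₁ = 0) (h22 : sesq M x₂ x₂ = 0) (h12 : sesq M x₁ x₂ = 1)
    (h21 : sesq M x₂ x₁ = 0) (h32 : sesq M x₃ x₂ = 0) (h13 : sesq M x₁ x₃ = 0)
    (hs : sesq M x₂ x₃ ≠ 0 ∨ (sesq M x₃ x₁ = 0 ∧ sesq M x₃ x₃ = 0))
    (hA₁ : hermForm A x₁ < 0) (hA₂ : 0 < hermForm A x₂) :
    ∃ z ∈ W, z ≠ 0 ∧ sesq M z z = 0 ∧ hermForm A z = 0 := by
  have hcomb := sesq_comb M x₁ x₂ x₃ h11 h22 h12 h21 h32 h13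
  by_cases hpc : sesq M x₃ x₁ = 0 ∧ sesq M x₃ x₃ = 0
  · refine exists_zero_on_two_segments M A
      (y := (-star (sesq M x₂ x₃)) • x₁ + (0 : ℂ) • x₂ + (1 : ℂ) • x₃) hx₁ ?_ hx₂
      (comb_ne_zero hli (by simp)) h11 ?_ h22 ?_ ?_ hA₁ hA₂
    · exact W.add_mem (W.add_mem (W.smul_mem _ hx₁) (W.smul_mem _ hx₂)) (W.smul_mem _ hx₃)
    · rw [hcomb]; simp [hpc.1, hpc.2]
    · simp [-neg_smul, sesq_add_left, sesq_add_right, sesq_smul_left, sesq_smul_right, h11,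
        h13, hpc.1]
    · simp [-neg_smul, sesq_add_left, sesq_add_right, sesq_smul_left, sesq_smul_right, h21,
        h12, h32]
  have hs0 : sesq M x₂ x₃ ≠ 0 := hs.resolve_right hpc
  set p := sesq M x₃ x₁
  set s := sesq M x₂ x₃
  set c := sesq M x₃ x₃
  have hn : 0 < ‖s‖ := norm_pos_iff.2 hs0
  have hss : s * star s = ((‖s‖ : ℝ) : ℂ) ^ 2 := Complex.mul_conj' s
  obtain ⟨w, hw, hne⟩ := exists_unit_trig_ne_zero hs0 (inv_ne_zero hn.ne') hpc
  have hw0 : w ≠ 0 := by rintro rfl; simp at hw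
  refine exists_zero_on_path M A (a := 0) (b := ‖s‖⁻¹) (by positivity)
    (fun u : ℝ => ((1 - (‖s‖ : ℂ) ^ 2 * (u : ℂ) ^ 2) * w) • x₁ +
      (u * (-p * w ^ 2 - c * w * u + s * star p * star w * u + s * star c * (u : ℂ) ^ 2)) • x₂ +
      ((1 - (‖s‖ : ℂ) ^ 2 * (u : ℂ) ^ 2) * u) • x₃) (by fun_prop) ?_ ?_ ?_ ?_ ?_
  · intro u _
    exact W.add_mem (W.add_mem (W.smul_mem _ hx₁) (W.smul_mem _ hx₂)) (W.smul_mem _ hx₃)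
  · intro u _
    rw [hcomb, ← hss]
    simp only [Complex.star_def] at hw ⊢
    simp only [map_mul, map_sub, map_add, map_pow, map_neg, map_one, Complex.conj_ofReal,
      Complex.conj_conj]
    set w' := (starRingEnd ℂ) w
    set p' := (starRingEnd ℂ) p
    set c' := (starRingEnd ℂ) c
    set s' := (starRingEnd ℂ) s
    linear_combination (s' * s * u ^ 3 * p * w + s' * s * u ^ 4 * c - u * p * w - u ^ 2 * c) * hw
  · intro u hu h
    -- at the end of the path only the coefficient of `x₂` survives, nonzero by the choice of `w`
    by_cases hD : (1 - (‖s‖ : ℂ) ^ 2 * (u : ℂ) ^ 2) = 0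
    · have hu' : u = ‖s‖⁻¹ := by
        have h1 : 1 - ‖s‖ ^ 2 * u ^ 2 = 0 := by exact_mod_cast hD
        have h2 : (‖s‖ * u) ^ 2 = 1 := by linear_combination -h1
        have h3 : ‖s‖ * u = 1 := by
          have := mul_nonneg hn.le hu.1
          nlinarith
        exact eq_inv_of_mul_eq_one_right h3
      refine comb_ne_zero hli (Or.inr (Or.inl (mul_ne_zero ?_ ?_)))
      · rw [hu']; exact_mod_cast inv_ne_zero hn.ne'
      · rw [hu']; exact hne
    · exact comb_ne_zero hli (Or.inl (mul_ne_zero hD hw0))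
  · have : Complex.normSq w = 1 := by
      have := Complex.normSq_eq_conj_mul_self (z := w)
      rw [← Complex.star_def, hw] at this
      exact_mod_cast this
    simp [hermForm_smul, this, hA₁.le]
  · have : (1 - (‖s‖ : ℂ) ^ 2 * ((‖s‖⁻¹ : ℝ) : ℂ) ^ 2) = 0 := by
      have : (‖s‖ : ℂ) ≠ 0 := by exact_mod_cast hn.ne'
      push_cast
      field_simp
      ring
    simp only [this, zero_mul, zero_smul, zero_add, add_zero, hermForm_smul]
    exact mul_nonneg (Complex.normSq_nonneg _) hA₂.le

/-- The normalised path argument: if `M` has the values of `ᾱβ` on the span of `x₁, x₂`, and `x₃` is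
shifted so that only four coefficients survive, then `[x₁]` and `[x₂]` are joined by a path in the
projective zero set of `M`. -/
theorem exists_zero_of_normalized {W : Submodule ℂ (Fin n → ℂ)}
    (M A : Matrix (Fin n) (Fin n) ℂ) {x₁ x₂ x₃ : Fin n → ℂ} (hx₁ : x₁ ∈ W) (hx₂ : x₂ ∈ W)
    (hx₃ : x₃ ∈ W) (hli : LinearIndependent ℂ ![x₁, x₂, x₃])
    (h11 : sesq M x₁ x₁ = 0) (h22 : sesq M x₂ x₂ = 0) (h12 : sesq M x₁ x₂ = 1)
    (h21 : sesq M x₂ x₁ = 0) (h32 : sesq M x₃ x₂ = 0) (h13 : sesq M x₁ x₃ = 0)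
    (hA₁ : hermForm A x₁ < 0) (hA₂ : 0 < hermForm A x₂) :
    ∃ z ∈ W, z ≠ 0 ∧ sesq M z z = 0 ∧ hermForm A z = 0 := by
  by_cases hs : sesq M x₂ x₃ ≠ 0 ∨ (sesq M x₃ x₁ = 0 ∧ sesq M x₃ x₃ = 0)
  · exact exists_zero_of_normalized_of_ne M A hx₁ hx₂ hx₃ hli h11 h22 h12 h21 h32 h13 hs hA₁ hA₂
  push Not at hs
  obtain ⟨hs, hpc⟩ := hs
  by_cases hp : sesq M x₃ x₁ = 0
  · -- with `s = p = 0` the condition on the coefficients is `ᾱβ + c|γ|² = 0`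
    have hc := hpc hp
    set c := sesq M x₃ x₃
    refine exists_zero_on_path M A zero_le_one (fun t : ℝ => ((1 - t : ℂ) ^ 2) • x₁ +
      (-c * (t : ℂ) ^ 2) • x₂ + (t * (1 - t : ℂ)) • x₃) (by fun_prop) ?_ ?_ ?_ ?_ ?_
    · intro t _
      exact W.add_mem (W.add_mem (W.smul_mem _ hx₁) (W.smul_mem _ hx₂)) (W.smul_mem _ hx₃)
    · intro t _
      rw [sesq_comb M x₁ x₂ x₃ h11 h22 h12 h21 h32 h13, hs, hp]
      simp only [Complex.star_def, map_mul, map_sub, map_pow, map_neg, map_one,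
        Complex.conj_ofReal]
      ring
    · intro t _ _
      apply comb_ne_zero hli
      by_cases ht : (t : ℂ) = 0
      · left; simp [ht]
      · right; left; simp [ht, hc]
    · simp [hA₁.le]
    · simpa [-neg_smul, hermForm_smul] using mul_nonneg (Complex.normSq_nonneg c) hA₂.le
  · -- exchange the roles of `x₁` and `x₂`, passing to `Mᴴ` and `-A`
    have hli' : LinearIndependent ℂ ![x₂, x₁, x₃] := by
      have := hli.comp (Equiv.swap (0 : Fin 3) 1) (Equiv.injective _)
      convert this using 1
      ext i; fin_cases i <;> simp [Equiv.swap_apply_def]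
    obtain ⟨z, hz, hz0, hMz, hAz⟩ := exists_zero_of_normalized_of_ne Mᴴ (-A) hx₂ hx₁ hx₃ hli'
      (by simp [sesq_conjTranspose, h22]) (by simp [sesq_conjTranspose, h11])
      (by simp [sesq_conjTranspose, h12]) (by simp [sesq_conjTranspose, h21])
      (by simp [sesq_conjTranspose, h13]) (by simp [sesq_conjTranspose, h32])
      (Or.inl (by simpa [sesq_conjTranspose] using hp))
      (by simpa [hermForm_neg_mat] using hA₂) (by simpa [hermForm_neg_mat] using hA₁)
    exact ⟨z, hz, hz0, by simpa [sesq_conjTranspose] using hMz,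
      by simpa [hermForm_neg_mat] using hAz⟩

/-- If `A` takes both signs at two zeros `x₁, x₂` of `M`, the real and imaginary parts of `M` are
nondegenerate on the span of `x₁, x₂`, and a third independent direction is available, then `M` and
`A` have a common isotropic vector. -/
theorem exists_zero_of_three {W : Submodule ℂ (Fin n → ℂ)}
    (M A : Matrix (Fin n) (Fin n) ℂ) {x₁ x₂ x₃ : Fin n → ℂ} (hx₁ : x₁ ∈ W) (hx₂ : x₂ ∈ W)
    (hx₃ : x₃ ∈ W) (hli : LinearIndependent ℂ ![x₁, x₂, x₃])
    (h11 : sesq M x₁ x₁ = 0) (h22 : sesq M x₂ x₂ = 0)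
    (hne : Complex.normSq (sesq M x₁ x₂) ≠ Complex.normSq (sesq M x₂ x₁))
    (hA₁ : hermForm A x₁ < 0) (hA₂ : 0 < hermForm A x₂) :
    ∃ z ∈ W, z ≠ 0 ∧ sesq M z z = 0 ∧ hermForm A z = 0 := by
  set a := sesq M x₁ x₂
  set b := sesq M x₂ x₁
  -- `N = δ⁻¹ (ā M - b Mᴴ)` has the same isotropic vectors, and `x₁ᴴ N x₂ = 1`, `x₂ᴴ N x₁ = 0`
  set δ : ℂ := star a * a - b * star b
  have hδ : δ ≠ 0 := by
    simp only [δ, Complex.star_def, ← Complex.normSq_eq_conj_mul_self, Complex.mul_conj]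
    exact_mod_cast sub_ne_zero.2 hne
  set N := δ⁻¹ • (star a • M + (-b) • Mᴴ)
  have hN : ∀ x y, sesq N x y = δ⁻¹ * (star a * sesq M x y - b * star (sesq M y x)) := by
    intro x y
    simp only [N, sesq_smul_mat, sesq_add_mat, sesq_conjTranspose]
    ring
  have e11 : sesq N x₁ x₁ = 0 := by simp [hN, h11]
  have e22 : sesq N x₂ x₂ = 0 := by simp [hN, h22]
  have e12 : sesq N x₁ x₂ = 1 := by rw [hN]; exact inv_mul_cancel₀ hδ
  have e21 : sesq N x₂ x₁ = 0 := by
    rw [hN]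
    change δ⁻¹ * (star a * b - b * star a) = 0
    ring
  -- `y` is `x₃` made orthogonal to `x₁` on one side and to `x₂` on the other
  set y := (-star (sesq N x₃ x₂)) • x₁ + (-sesq N x₁ x₃) • x₂ + (1 : ℂ) • x₃ with hy
  have hli' : LinearIndependent ℂ ![x₁, x₂, y] := by
    rw [Fintype.linearIndependent_iff]
    intro g hg
    have h := Fintype.linearIndependent_iff.1 hli
      ![g 0 - g 2 * star (sesq N x₃ x₂), g 1 - g 2 * sesq N x₁ x₃, g 2] (by
        rw [← hg]
        simp [Fin.sum_univ_three, hy]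
        module)
    have g2 : g 2 = 0 := by simpa using h 2
    have g0 : g 0 = 0 := by simpa [g2] using h 0
    have g1 : g 1 = 0 := by simpa [g2] using h 1
    intro i; fin_cases i <;> assumption
  obtain ⟨z, hz, hz0, hNz, hAz⟩ := exists_zero_of_normalized N A hx₁ hx₂
    (W.add_mem (W.add_mem (W.smul_mem _ hx₁) (W.smul_mem _ hx₂)) (W.smul_mem _ hx₃) : y ∈ W)
    hli' e11 e22 e12 e21
    (by simp [-neg_smul, sesq_add_left, sesq_smul_left, e12, e22])
    (by simp [-neg_smul, sesq_add_right, sesq_smul_right, e11, e12]) hA₁ hA₂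
  refine ⟨z, hz, hz0, ?_, hAz⟩
  rw [hN] at hNz
  have h1 : star a * sesq M z z = b * star (sesq M z z) :=
    sub_eq_zero.1 ((mul_eq_zero.1 hNz).resolve_left (inv_ne_zero hδ))
  have h2 := congrArg Complex.normSq h1
  simp only [Complex.star_def, Complex.normSq_mul, Complex.normSq_conj] at h2
  by_contra h3
  exact hne (mul_right_cancel₀ (mt Complex.normSq_eq_zero.1 h3) h2)

end Path

/-! ### Two forms vanishing, one form signed -/

section TwoPoint

variable {n : ℕ}

/-- Surjectivity of the Hopf map `(u, w) ↦ (|u|² - |w|², 2 ū w)`. -/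
theorem exists_hopf_preimage (s : ℝ) (σ : ℂ) :
    ∃ u w : ℂ, Complex.normSq u - Complex.normSq w = s ∧ 2 * (star u * w) = σ := by
  set r := Real.sqrt (s ^ 2 + Complex.normSq σ)
  have hσ := Complex.normSq_nonneg σ
  have hr : r ^ 2 = s ^ 2 + Complex.normSq σ := Real.sq_sqrt (by positivity)
  have hr0 : 0 ≤ r := Real.sqrt_nonneg _
  have hrs : 0 ≤ r + s := by nlinarith [abs_le_of_sq_le_sq (show s ^ 2 ≤ r ^ 2 by linarith) hr0]
  rcases hrs.eq_or_lt with h | h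
  · have h2 : Complex.normSq σ = 0 := by
      have : s = -r := by linarith
      rw [this] at hr; linarith
    refine ⟨0, (Real.sqrt r : ℂ), ?_, ?_⟩
    · rw [Complex.normSq_ofReal, Real.mul_self_sqrt hr0]; simp; linarith
    · simp [Complex.normSq_eq_zero.1 h2]
  · set q := Real.sqrt ((r + s) / 2)
    have hq : q ^ 2 = (r + s) / 2 := Real.sq_sqrt (by linarith)
    have hq0 : 0 < q := Real.sqrt_pos.2 (by linarith)
    refine ⟨(q : ℂ), σ / (2 * q), ?_, ?_⟩
    · simp only [Complex.normSq_div, Complex.normSq_mul, Complex.normSq_ofReal]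
      have : Complex.normSq 2 = 4 := by norm_num [Complex.normSq_apply]
      rw [this]
      have h3 : Complex.normSq σ = (r - s) * (2 * q ^ 2) := by rw [hq]; linear_combination -hr
      rw [h3]
      field_simp
      rw [hq]; ring
    · have : (q : ℂ) ≠ 0 := by exact_mod_cast hq0.ne'
      simp
      field_simp

theorem exists_ne_zero_orthogonal (a₁ b₁ c₁ a₂ b₂ c₂ : ℝ) :
    ∃ x y z : ℝ, (x ≠ 0 ∨ y ≠ 0 ∨ z ≠ 0) ∧ a₁ * x + b₁ * y + c₁ * z = 0 ∧
      a₂ * x + b₂ * y + c₂ * z = 0 := by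
  have h : LinearMap.ker (Matrix.mulVecLin !![a₁, b₁, c₁; a₂, b₂, c₂]) ≠ ⊥ :=
    LinearMap.ker_ne_bot_of_finrank_lt (by simp)
  obtain ⟨v, hv, hv0⟩ := Submodule.exists_mem_ne_zero_of_ne_bot h
  have h1 := congrFun hv 0
  have h2 := congrFun hv 1
  simp [Matrix.mulVec, dotProduct, Fin.sum_univ_three] at h1 h2
  refine ⟨v 0, v 1, v 2, ?_, h1, h2⟩
  by_contra! h3
  exact hv0 (funext fun i => by fin_cases i <;> simp [h3])

/-- On the span of two vectors where three Hermitian forms have opposite values, the forms are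
linear functionals on the Bloch sphere; a point of the sphere orthogonal to two of them, or its
antipode, makes the third nonpositive. -/
theorem exists_isotropic_nonpos {W : Submodule ℂ (Fin n → ℂ)} {A B C : Matrix (Fin n) (Fin n) ℂ}
    (hA : A.IsHermitian) (hB : B.IsHermitian) (hC : C.IsHermitian) {x y : Fin n → ℂ}
    (hx : x ∈ W) (hy : y ∈ W) (hx0 : x ≠ 0)
    (hAxy : hermForm A x + hermForm A y = 0) (hBxy : hermForm B x + hermForm B y = 0)
    (hCxy : hermForm C x + hermForm C y = 0) :
    ∃ z ∈ W, z ≠ 0 ∧ hermForm A z = 0 ∧ hermForm B z = 0 ∧ hermForm C z ≤ 0 := by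
  by_cases hli : ∀ s t : ℂ, s • x + t • y = 0 → s = 0 ∧ t = 0
  · obtain ⟨s₀, s₁, s₂, hs, h1, h2⟩ := exists_ne_zero_orthogonal (hermForm A x) (sesq A x y).re
      (-(sesq A x y).im) (hermForm B x) (sesq B x y).re (-(sesq B x y).im)
    obtain ⟨e, he, hCe⟩ : ∃ e : ℝ, e ≠ 0 ∧
        e * (hermForm C x * s₀ + (sesq C x y).re * s₁ - (sesq C x y).im * s₂) ≤ 0 := by
      rcases le_total (hermForm C x * s₀ + (sesq C x y).re * s₁ - (sesq C x y).im * s₂) 0 with h | h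
      · exact ⟨1, one_ne_zero, by linarith⟩
      · exact ⟨-1, by norm_num, by linarith⟩
    obtain ⟨u, w, huw, huw'⟩ := exists_hopf_preimage (e * s₀) ⟨e * s₁, e * s₂⟩
    have key : ∀ D : Matrix (Fin n) (Fin n) ℂ, D.IsHermitian → hermForm D x + hermForm D y = 0 →
        hermForm D (u • x + w • y) =
          e * (hermForm D x * s₀ + (sesq D x y).re * s₁ - (sesq D x y).im * s₂) := by
      intro D hD hDxy
      have h3 : 2 * (star u * w * sesq D x y).re =
          ((⟨e * s₁, e * s₂⟩ : ℂ) * sesq D x y).re := by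
        rw [← huw', mul_assoc 2, ← Complex.re_ofReal_mul]; norm_num
      rw [hermForm_smul_add_smul hD, h3, Complex.mul_re]
      linear_combination hermForm D x * huw + Complex.normSq w * hDxy
    refine ⟨u • x + w • y, W.add_mem (W.smul_mem _ hx) (W.smul_mem _ hy), ?_, ?_, ?_, ?_⟩
    · intro h0
      obtain ⟨rfl, rfl⟩ := hli u w h0
      simp only [map_zero, sub_zero, mul_zero] at huw huw'
      have h4 := congrArg Complex.re huw'
      have h5 := congrArg Complex.im huw'
      simp [he] at huw h4 h5
      simp_all
    · rw [key A hA hAxy]; linear_combination e * h1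
    · rw [key B hB hBxy]; linear_combination e * h2
    · rw [key C hC hCxy]; exact hCe
  · -- for proportional `x`, `y` all three forms vanish at `x`
    push Not at hli
    obtain ⟨s, t, hst, h⟩ := hli
    have ht : t ≠ 0 := by
      rintro rfl
      simp [hx0] at hst
      exact h hst rfl
    have key : ∀ D : Matrix (Fin n) (Fin n) ℂ, hermForm D x + hermForm D y = 0 →
        hermForm D x = 0 := by
      intro D hD
      have h1 : s • x = (-t) • y := by rw [neg_smul]; exact eq_neg_of_add_eq_zero_left hst
      have h2 := congrArg (hermForm D) h1
      rw [hermForm_smul, hermForm_smul, Complex.normSq_neg] at h2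
      have h3 : (Complex.normSq s + Complex.normSq t) * hermForm D x = 0 := by
        linear_combination h2 + Complex.normSq t * hD
      have h4 := Complex.normSq_pos.2 ht
      have h5 := Complex.normSq_nonneg s
      exact (mul_eq_zero.1 h3).resolve_left (by linarith)
    exact ⟨x, hx, hx0, key A hAxy, key B hBxy, (key C hCxy).le⟩

theorem isHermitian_real_smul {A : Matrix (Fin n) (Fin n) ℂ} (hA : A.IsHermitian) (r : ℝ) :
    (r • A).IsHermitian := by
  rw [Matrix.IsHermitian, Matrix.conjTranspose_smul, hA.eq, star_trivial]

theorem exists_normalizing {z : Fin n → ℂ} (hz : z ≠ 0) :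
    ∃ r : ℝ, 0 < r ∧ r * hermForm 1 z = 1 ∧
      ∀ A : Matrix (Fin n) (Fin n) ℂ, hermForm A ((Real.sqrt r : ℂ) • z) = r * hermForm A z := by
  have h := hermForm_one_pos hz
  refine ⟨(hermForm 1 z)⁻¹, inv_pos.2 h, inv_mul_cancel₀ h.ne', fun A => ?_⟩
  rw [hermForm_smul, Complex.normSq_ofReal, Real.mul_self_sqrt (inv_pos.2 h).le]

/-- The joint numerical range of three Hermitian forms becomes convex when it is filled upwards in
the third coordinate. The coordinates are read off through linear functionals `f`, `g`, `h`. -/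
theorem convex_filled_range {E : Type*} [AddCommGroup E] [Module ℝ E] (W : Submodule ℂ (Fin n → ℂ))
    {A B C : Matrix (Fin n) (Fin n) ℂ} (hA : A.IsHermitian) (hB : B.IsHermitian)
    (hC : C.IsHermitian) (f g h : E →ₗ[ℝ] ℝ) :
    Convex ℝ {v : E | ∃ z ∈ W, hermForm 1 z = 1 ∧ hermForm A z = f v ∧ hermForm B z = g v ∧
      hermForm C z ≤ h v} := by
  rw [convex_iff_forall_pos]
  rintro v ⟨z, hz, hz1, hAz, hBz, hCz⟩ v' ⟨z', hz', hz1', hAz', hBz', hCz'⟩ a b ha hb hab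
  have hne : ∀ y : Fin n → ℂ, hermForm 1 y = 1 → y ≠ 0 := by
    rintro y hy rfl
    simp [hermForm_zero] at hy
  have hscale : ∀ (D : Matrix (Fin n) (Fin n) ℂ) (r : ℝ) (y : Fin n → ℂ), 0 < r →
      hermForm D ((Real.sqrt r : ℂ) • y) = r * hermForm D y := by
    intro D r y hr
    rw [hermForm_smul, Complex.normSq_ofReal, Real.mul_self_sqrt hr.le]
  have hsqrt : ∀ r : ℝ, 0 < r → (Real.sqrt r : ℂ) ≠ 0 := fun r hr => by
    exact_mod_cast (Real.sqrt_pos.2 hr).ne'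
  have hshift : ∀ (D : Matrix (Fin n) (Fin n) ℂ) (c : ℝ) (y : Fin n → ℂ),
      hermForm (D + (-c) • (1 : Matrix (Fin n) (Fin n) ℂ)) y =
        hermForm D y - c * hermForm 1 y := by
    intro D c y
    rw [hermForm_add_mat, hermForm_smul_mat]; ring
  have hherm : ∀ (D : Matrix (Fin n) (Fin n) ℂ) (c : ℝ), D.IsHermitian →
      (D + (-c) • (1 : Matrix (Fin n) (Fin n) ℂ)).IsHermitian := fun D c hD =>
    hD.add (isHermitian_real_smul Matrix.isHermitian_one _)
  -- subtracting multiples of the identity moves the target point to the origin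
  have hsum : ∀ D : Matrix (Fin n) (Fin n) ℂ,
      hermForm (D + (-(a * hermForm D z + b * hermForm D z')) • (1 : Matrix (Fin n) (Fin n) ℂ))
          ((Real.sqrt a : ℂ) • z) +
        hermForm (D + (-(a * hermForm D z + b * hermForm D z')) • (1 : Matrix (Fin n) (Fin n) ℂ))
          ((Real.sqrt b : ℂ) • z') = 0 := by
    intro D
    rw [hscale _ _ _ ha, hscale _ _ _ hb, hshift, hshift, hz1, hz1']
    linear_combination -(a * hermForm D z + b * hermForm D z') * hab
  obtain ⟨y, hy, hy0, h1, h2, h3⟩ := exists_isotropic_nonpos (hherm A _ hA) (hherm B _ hB)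
    (hherm C _ hC) (W.smul_mem _ hz) (W.smul_mem _ hz')
    (smul_ne_zero (hsqrt a ha) (hne z hz1)) (hsum A) (hsum B) (hsum C)
  rw [hshift] at h1 h2 h3
  obtain ⟨r, hr, hr1, hrD⟩ := exists_normalizing hy0
  refine ⟨_, W.smul_mem (Real.sqrt r : ℂ) hy, by rw [hrD, hr1], ?_, ?_, ?_⟩
  · rw [hrD, map_add, map_smul, map_smul, smul_eq_mul, smul_eq_mul, ← hAz, ← hAz']
    linear_combination r * h1 + (a * hermForm A z + b * hermForm A z') * hr1
  · rw [hrD, map_add, map_smul, map_smul, smul_eq_mul, smul_eq_mul, ← hBz, ← hBz']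
    linear_combination r * h2 + (a * hermForm B z + b * hermForm B z') * hr1
  · rw [hrD, map_add, map_smul, map_smul, smul_eq_mul, smul_eq_mul]
    have h4 : r * hermForm C y ≤ a * hermForm C z + b * hermForm C z' := by
      have := mul_le_mul_of_nonneg_left h3 hr.le
      linear_combination this + (a * hermForm C z + b * hermForm C z') * hr1
    have h5 := mul_le_mul_of_nonneg_left hCz ha.le
    have h6 := mul_le_mul_of_nonneg_left hCz' hb.le
    linarith

end TwoPoint

/-! ### Convex hulls and Lagrange multipliers -/

section Convexity

theorem IsCompact.convexHull_of_finiteDimensional {E : Type*} [NormedAddCommGroup E]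
    [NormedSpace ℝ E] [FiniteDimensional ℝ E] {K : Set E} (hK : IsCompact K) :
    IsCompact (convexHull ℝ K) := by
  set m := Module.finrank ℝ E + 1
  have himage : convexHull ℝ K = (fun q : (Fin m → ℝ) × (Fin m → E) => ∑ i, q.1 i • q.2 i) ''
      (stdSimplex ℝ (Fin m) ×ˢ Set.univ.pi fun _ => K) := by
    apply Set.Subset.antisymm
    · intro x hx
      obtain ⟨ι, _, z, w, hz, hai, hw, hw1, rfl⟩ := eq_pos_convex_span_of_mem_convexHull hx
      have hcard : Fintype.card ι ≤ Fintype.card (Fin m) := by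
        rw [Fintype.card_fin]
        exact hai.card_le_finrank_succ.trans (Nat.succ_le_succ (Submodule.finrank_le _))
      obtain ⟨e⟩ := Function.Embedding.nonempty_of_card_le hcard
      obtain ⟨k₀, hk₀⟩ : K.Nonempty := convexHull_nonempty_iff.1 ⟨_, hx⟩
      refine ⟨(Function.extend e w 0, Function.extend e z fun _ => k₀), ⟨⟨?_, ?_⟩, ?_⟩, ?_⟩
      · intro i
        by_cases hi : ∃ j, e j = i
        · obtain ⟨j, rfl⟩ := hi
          simpa only [e.injective.extend_apply] using (hw j).le
        · simp [Function.extend_apply' _ _ _ hi]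
      · rw [← hw1]
        refine (Fintype.sum_of_injective e e.injective _ _ ?_ ?_).symm
        · intro i hi; exact Function.extend_apply' _ _ _ hi
        · intro j; exact (e.injective.extend_apply _ _ _).symm
      · intro i _
        by_cases hi : ∃ j, e j = i
        · obtain ⟨j, rfl⟩ := hi
          simp only [e.injective.extend_apply]; exact hz ⟨j, rfl⟩
        · simpa only [Function.extend_apply' _ _ _ hi] using hk₀
      · refine (Fintype.sum_of_injective e e.injective _ _ ?_ ?_).symm
        · intro i hi
          simp [Function.extend_apply' _ _ _ hi]
        · intro j; simp [e.injective.extend_apply]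
    · rintro _ ⟨⟨w, z⟩, ⟨hw, hz⟩, rfl⟩
      exact (convex_convexHull ℝ K).sum_mem (fun i _ => hw.1 i) hw.2
        fun i _ => subset_convexHull ℝ K (hz i (Set.mem_univ i))
  rw [himage]
  exact ((isCompact_stdSimplex ℝ (Fin m)).prod (isCompact_univ_pi fun _ => hK)).image
    (by fun_prop)

/-- The part of a convex set lying in the boundary hyperplane of an open half-space can be adjoined
to the half-space without losing convexity. -/
theorem convex_halfSpace_union_face {E : Type*} [AddCommGroup E] [Module ℝ E] (f : E →ₗ[ℝ] ℝ)
    (p : ℝ) {N : Set E} (hN : Convex ℝ N) : Convex ℝ {v | p < f v ∨ (f v = p ∧ v ∈ N)} := by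
  rw [convex_iff_forall_pos]
  rintro v hv v' hv' a b ha hb hab
  have hle : ∀ u, (p < f u ∨ (f u = p ∧ u ∈ N)) → p ≤ f u := by
    rintro u (h | h)
    exacts [h.le, h.1.ge]
  have h1 := hle v hv
  have h2 := hle v' hv'
  simp only [Set.mem_ofPred_eq, map_add, map_smul, smul_eq_mul]
  have hp : p = a * p + b * p := by rw [← add_mul, hab, one_mul]
  rcases hv with hv | ⟨hv, hvN⟩
  · left
    nlinarith [mul_lt_mul_of_pos_left hv ha, mul_le_mul_of_nonneg_left h2 hb.le]
  rcases hv' with hv' | ⟨hv', hvN'⟩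
  · left
    nlinarith [mul_lt_mul_of_pos_left hv' hb, mul_le_mul_of_nonneg_left h1 ha.le]
  · right
    exact ⟨by rw [hv, hv', ← hp], hN hvN hvN' ha.le hb.le hab⟩

/-- Strong duality for minimising the coordinate `v 0` over a compact convex set under three
constraints `v k ≤ 0` with a strictly feasible point: the minimum is attained and has Lagrange
multipliers. -/
theorem exists_minimizer_multipliers {S : Set (Fin 4 → ℝ)} (hS : IsCompact S) (hc : Convex ℝ S)
    (hslater : ∃ v ∈ S, v 1 < 0 ∧ v 2 < 0 ∧ v 3 < 0) :
    ∃ v ∈ S, ∃ μ₁ μ₂ μ₃ : ℝ, (v 1 ≤ 0 ∧ v 2 ≤ 0 ∧ v 3 ≤ 0) ∧ (0 ≤ μ₁ ∧ 0 ≤ μ₂ ∧ 0 ≤ μ₃) ∧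
      ∀ u ∈ S, v 0 ≤ u 0 + μ₁ * u 1 + μ₂ * u 2 + μ₃ * u 3 := by
  obtain ⟨x, hxS, hx1, hx2, hx3⟩ := hslater
  have hF : IsCompact (S ∩ {v | v 1 ≤ 0 ∧ v 2 ≤ 0 ∧ v 3 ≤ 0}) := by
    have hi : ∀ i : Fin 4, IsClosed {u : Fin 4 → ℝ | u i ≤ 0} := fun i =>
      isClosed_le (continuous_apply i) continuous_const
    exact hS.inter_right ((hi 1).inter ((hi 2).inter (hi 3)))
  obtain ⟨v, ⟨hvS, hv⟩, hmin⟩ := hF.exists_isMinOn ⟨x, hxS, hx1.le, hx2.le, hx3.le⟩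
    (f := fun v : Fin 4 → ℝ => v 0) (by fun_prop)
  set p := v 0
  set U : Set (Fin 4 → ℝ) := {u | u 0 < p ∧ u 1 < 0 ∧ u 2 < 0 ∧ u 3 < 0}
  have hUo : IsOpen U := by
    have hi : ∀ (i : Fin 4) (r : ℝ), IsOpen {u : Fin 4 → ℝ | u i < r} := fun i _ =>
      isOpen_lt (continuous_apply i) continuous_const
    exact (hi 0 p).inter ((hi 1 0).inter ((hi 2 0).inter (hi 3 0)))
  have hUc : Convex ℝ U := by
    have hi : ∀ (i : Fin 4) (r : ℝ), Convex ℝ {u : Fin 4 → ℝ | u i < r} := fun i r =>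
      convex_halfSpace_lt (LinearMap.proj (R := ℝ) (φ := fun _ : Fin 4 => ℝ) i).isLinear r
    exact (hi 0 p).inter ((hi 1 0).inter ((hi 2 0).inter (hi 3 0)))
  have hdisj : Disjoint U S := by
    rw [Set.disjoint_left]
    rintro u ⟨h0, h1, h2, h3⟩ huS
    exact (hmin ⟨huS, h1.le, h2.le, h3.le⟩).not_gt h0
  obtain ⟨f, s, hfU, hfS⟩ := geometric_hahn_banach_open hUc hUo hc hdisj
  set l : Fin 4 → ℝ := fun i => f (Pi.single i 1)
  have hf : ∀ u, f u = l 0 * u 0 + l 1 * u 1 + l 2 * u 2 + l 3 * u 3 := by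
    intro u
    have h := LinearMap.pi_apply_eq_sum_univ (f : (Fin 4 → ℝ) →ₗ[ℝ] ℝ) u
    have h' : ∀ i : Fin 4, (fun j => if i = j then (1 : ℝ) else 0) = Pi.single i 1 := by
      intro i; ext j; simp [Pi.single_apply, eq_comm]
    simp only [Fin.sum_univ_four, h', smul_eq_mul] at h
    change f u = u 0 * l 0 + u 1 * l 1 + u 2 * l 2 + u 3 * l 3 at h
    rw [h]; ring
  have hfU' : ∀ a b c d : ℝ, a < p → b < 0 → c < 0 → d < 0 →
      l 0 * a + l 1 * b + l 2 * c + l 3 * d < s := by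
    intro a b c d ha hb hc hd
    have := hfU ![a, b, c, d] ⟨by simpa, by simpa, by simpa, by simpa⟩
    rw [hf] at this
    simpa using this
  -- the open orthant is unbounded below in each coordinate, so no coefficient is negative
  have hpos : ∀ k m : ℝ, (∀ t : ℝ, 0 ≤ t → m - k * t < s) → 0 ≤ k := by
    intro k m h
    by_contra! hk
    have h1 := h (|s - m| / (-k)) (by have := neg_pos.2 hk; positivity)
    have h2 : k * (|s - m| / (-k)) = -|s - m| := by
      rw [div_neg, mul_neg, mul_div_cancel₀ _ hk.ne]
    rw [h2] at h1
    linarith [le_abs_self (s - m)]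
  have h0 : 0 ≤ l 0 := hpos _ (l 0 * (p - 1) - l 1 - l 2 - l 3) fun t ht => by
    linarith [hfU' (p - 1 - t) (-1) (-1) (-1) (by linarith) (by simp) (by simp) (by simp)]
  have h1 : 0 ≤ l 1 := hpos _ (l 0 * (p - 1) - l 1 - l 2 - l 3) fun t ht => by
    linarith [hfU' (p - 1) (-1 - t) (-1) (-1) (by linarith) (by linarith) (by simp) (by simp)]
  have h2 : 0 ≤ l 2 := hpos _ (l 0 * (p - 1) - l 1 - l 2 - l 3) fun t ht => by
    linarith [hfU' (p - 1) (-1) (-1 - t) (-1) (by linarith) (by simp) (by linarith) (by simp)]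
  have h3 : 0 ≤ l 3 := hpos _ (l 0 * (p - 1) - l 1 - l 2 - l 3) fun t ht => by
    linarith [hfU' (p - 1) (-1) (-1) (-1 - t) (by linarith) (by simp) (by simp) (by linarith)]
  have hs : l 0 * p ≤ s := by
    by_contra! h
    set L := l 0 + l 1 + l 2 + l 3
    set ε := (l 0 * p - s) / (L + 1)
    have hL : 0 ≤ L := by positivity
    have hε : 0 < ε := div_pos (by linarith) (by linarith)
    have h4 : ε * (L + 1) = l 0 * p - s := div_mul_cancel₀ _ (by linarith)
    have h5 := hfU' (p - ε) (-ε) (-ε) (-ε) (by linarith) (by linarith) (by linarith) (by linarith)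
    simp only [L] at h4
    linarith
  have hl0 : 0 < l 0 := by
    refine h0.lt_of_ne fun h => ?_
    rw [← h, zero_mul] at hs
    have h4 := hfS x hxS
    rw [hf, ← h] at h4
    have h5 := mul_nonpos_of_nonneg_of_nonpos h1 hx1.le
    have h6 := mul_nonpos_of_nonneg_of_nonpos h2 hx2.le
    have h7 := mul_nonpos_of_nonneg_of_nonpos h3 hx3.le
    have e1 : l 1 = 0 := (mul_eq_zero.1 (by linarith : l 1 * x 1 = 0)).resolve_right hx1.ne
    have e2 : l 2 = 0 := (mul_eq_zero.1 (by linarith : l 2 * x 2 = 0)).resolve_right hx2.ne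
    have e3 : l 3 = 0 := (mul_eq_zero.1 (by linarith : l 3 * x 3 = 0)).resolve_right hx3.ne
    have h8 := hfU' (p - 1) (-1) (-1) (-1) (by linarith) (by simp) (by simp) (by simp)
    rw [← h, e1, e2, e3] at h8
    rw [e1, e2, e3] at h4
    linarith
  refine ⟨v, hvS, l 1 / l 0, l 2 / l 0, l 3 / l 0, hv, ⟨by positivity, by positivity,
    by positivity⟩, fun u hu => ?_⟩
  have h4 := hs.trans (hfS u hu)
  rw [hf] at h4
  have h5 : u 0 + l 1 / l 0 * u 1 + l 2 / l 0 * u 2 + l 3 / l 0 * u 3 =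
      (l 0 * u 0 + l 1 * u 1 + l 2 * u 2 + l 3 * u 3) / l 0 := by field_simp
  rw [h5, le_div_iff₀ hl0]
  linarith

end Convexity

/-! ### The exceptional configuration and the S-lemma -/

section Main

variable {n : ℕ}

theorem isCompact_unit_hermForm : IsCompact {x : Fin n → ℂ | hermForm 1 x = 1} := by
  refine Metric.isCompact_of_isClosed_isBounded
    (isClosed_eq (continuous_hermForm 1) continuous_const) ?_
  refine (Metric.isBounded_closedBall (x := (0 : Fin n → ℂ)) (r := 1)).subset fun x hx => ?_
  rw [mem_closedBall_zero_iff, pi_norm_le_iff_of_nonneg zero_le_one]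
  intro i
  have h : hermForm 1 x = ∑ i, ‖x i‖ ^ 2 := by
    simp [hermForm, sesq, dotProduct, Complex.sq_norm, Complex.normSq_apply]
  have h1 : ‖x i‖ ^ 2 ≤ ∑ i, ‖x i‖ ^ 2 :=
    Finset.single_le_sum (f := fun i => ‖x i‖ ^ 2) (fun _ _ => by positivity) (Finset.mem_univ i)
  rw [← h, hx] at h1
  exact (sq_le_one_iff₀ (norm_nonneg _)).1 h1

theorem exists_ne_zero_re_mul_eq_zero (a : ℂ) : ∃ w : ℂ, w ≠ 0 ∧ (a * w).re = 0 := by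
  by_cases ha : a = 0
  · exact ⟨1, one_ne_zero, by simp [ha]⟩
  · refine ⟨Complex.I * star a, mul_ne_zero Complex.I_ne_zero (star_ne_zero.2 ha), ?_⟩
    simp [Complex.mul_re, Complex.mul_im]; ring

theorem Matrix.IsHermitian.sesq_add_I_smul_self {A B : Matrix (Fin n) (Fin n) ℂ}
    (hA : A.IsHermitian) (hB : B.IsHermitian) (z : Fin n → ℂ) :
    sesq (A + Complex.I • B) z z = 0 ↔ hermForm A z = 0 ∧ hermForm B z = 0 := by
  rw [sesq_add_mat, sesq_smul_mat, ← ofReal_hermForm hA, ← ofReal_hermForm hB, Complex.ext_iff]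
  simp

/-- If three Hermitian forms have no common isotropic vector in `W`, while the third takes both
signs at common isotropic vectors of the first two, then `W` is a plane, spanned by vectors of the
shape demanded in `PropertyIC`. -/
theorem exists_span_of_no_common_zero {W : Submodule ℂ (Fin n → ℂ)}
    {A B C : Matrix (Fin n) (Fin n) ℂ} (hA : A.IsHermitian) (hB : B.IsHermitian)
    (hno : ∀ z ∈ W, z ≠ 0 → hermForm A z = 0 → hermForm B z = 0 → hermForm C z ≠ 0)
    {x y : Fin n → ℂ} (hx : x ∈ W) (hy : y ∈ W) (hAx : hermForm A x = 0) (hAy : hermForm A y = 0)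
    (hBx : hermForm B x = 0) (hBy : hermForm B y = 0) (hCx : hermForm C x < 0)
    (hCy : 0 < hermForm C y) :
    ∃ x₂, Submodule.span ℂ {x, x₂} = W ∧
      (sesq A x x = 0 ∧ sesq A x₂ x₂ = 0 ∧ (sesq A x x₂).re ≠ 0) ∧
      (sesq B x x = 0 ∧ sesq B x₂ x₂ = 0 ∧ (sesq B x x₂).re = 0 ∧ (sesq B x x₂).im ≠ 0) ∧
      (hermForm C x < 0 ∧ 0 < hermForm C x₂) := by
  set M := A + Complex.I • B with hMdef
  have hM : ∀ z, sesq M z z = 0 ↔ hermForm A z = 0 ∧ hermForm B z = 0 :=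
    hA.sesq_add_I_smul_self hB
  have hno' : ¬ ∃ z ∈ W, z ≠ 0 ∧ sesq M z z = 0 ∧ hermForm C z = 0 := by
    rintro ⟨z, hz, hz0, hMz, hCz⟩
    exact hno z hz hz0 ((hM z).1 hMz).1 ((hM z).1 hMz).2 hCz
  -- no phase makes both off-diagonal entries imaginary, by the segment from `x` to `w • y`
  have hphase : ∀ w : ℂ, w ≠ 0 → (sesq A x y * w).re = 0 → (sesq B x y * w).re = 0 → False := by
    intro w hw h1 h2
    have hstar : ∀ a : ℂ, a.re = 0 → a + star a = 0 := by
      intro a ha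
      apply Complex.ext <;> simp [ha]
    refine hno' (exists_zero_on_segment M C hx (W.smul_mem w hy) ((hM x).2 ⟨hAx, hBx⟩) ?_ ?_ hCx ?_)
    · rw [hM, hermForm_smul, hermForm_smul, hAy, hBy]; simp
    · have h3 := hstar _ h1
      have h4 := hstar _ h2
      rw [star_mul'] at h3 h4
      simp only [hMdef, sesq_add_mat, sesq_smul_mat, sesq_smul_right, sesq_smul_left,
        hA.sesq_comm x y, hB.sesq_comm x y]
      linear_combination h3 + Complex.I * h4
    · rw [hermForm_smul]; exact mul_pos (Complex.normSq_pos.2 hw) hCy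
  obtain ⟨w, hw, hBw⟩ := exists_ne_zero_re_mul_eq_zero (sesq B x y)
  have hAw : (sesq A x y * w).re ≠ 0 := fun h => hphase w hw h hBw
  have hBw' : (sesq B x y * w).im ≠ 0 := by
    intro h
    have h1 : sesq B x y = 0 :=
      (mul_eq_zero.1 (Complex.ext hBw h : sesq B x y * w = 0)).resolve_right hw
    obtain ⟨v, hv, hAv⟩ := exists_ne_zero_re_mul_eq_zero (sesq A x y)
    exact hphase v hv hAv (by simp [h1])
  set x₂ := w • y with hx₂
  have hx₂W : x₂ ∈ W := W.smul_mem w hy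
  have hAx₂ : hermForm A x₂ = 0 := by rw [hx₂, hermForm_smul, hAy, mul_zero]
  have hBx₂ : hermForm B x₂ = 0 := by rw [hx₂, hermForm_smul, hBy, mul_zero]
  have hCx₂ : 0 < hermForm C x₂ := by
    rw [hx₂, hermForm_smul]; exact mul_pos (Complex.normSq_pos.2 hw) hCy
  rw [mul_comm, ← sesq_smul_right, ← hx₂] at hAw hBw hBw'
  refine ⟨x₂, ?_, ⟨hA.sesq_self_eq_zero.2 hAx, hA.sesq_self_eq_zero.2 hAx₂, hAw⟩,
    ⟨hB.sesq_self_eq_zero.2 hBx, hB.sesq_self_eq_zero.2 hBx₂, hBw, hBw'⟩, hCx, hCx₂⟩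
  refine le_antisymm (Submodule.span_le.2 ?_) fun x₃ hx₃ => ?_
  · rintro _ (rfl | rfl)
    exacts [hx, hx₂W]
  by_contra hspan
  have hli : LinearIndependent ℂ ![x, x₂, x₃] := by
    rw [Fintype.linearIndependent_iff]
    intro g hg
    simp only [Fin.sum_univ_three, Matrix.cons_val_zero, Matrix.cons_val_one, Matrix.cons_val] at hg
    have g2 : g 2 = 0 := by
      by_contra h
      refine hspan (Submodule.mem_span_pair.2 ⟨-(g 0 / g 2), -(g 1 / g 2), ?_⟩)
      have h1 : x₃ = (g 2)⁻¹ • (g 2 • x₃) := by rw [smul_smul, inv_mul_cancel₀ h, one_smul]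
      have h2 : g 2 • x₃ = -(g 0 • x + g 1 • x₂) := by
        rw [eq_neg_iff_add_eq_zero, add_comm]; exact hg
      rw [h1, h2]
      module
    rw [g2, zero_smul, add_zero] at hg
    have h3 := congrArg (hermForm C) (eq_neg_of_add_eq_zero_left hg)
    rw [← neg_smul, hermForm_smul, hermForm_smul, Complex.normSq_neg] at h3
    have p0 := Complex.normSq_nonneg (g 0)
    have p1 := Complex.normSq_nonneg (g 1)
    have g0 : g 0 = 0 := by
      by_contra h
      nlinarith [mul_neg_of_pos_of_neg (Complex.normSq_pos.2 h) hCx, mul_nonneg p1 hCx₂.le]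
    have g1 : g 1 = 0 := by
      by_contra h
      nlinarith [mul_pos (Complex.normSq_pos.2 h) hCx₂, mul_nonneg p0 (neg_nonneg.2 hCx.le)]
    intro i; fin_cases i <;> assumption
  refine hno' (exists_zero_of_three M C hx hx₂W hx₃ hli ((hM x).2 ⟨hAx, hBx⟩)
    ((hM x₂).2 ⟨hAx₂, hBx₂⟩) ?_ hCx hCx₂)
  -- the difference of the two squared moduli is `-4 (Re xᴴAx₂) (Im xᴴBx₂)`
  simp only [hMdef, sesq_add_mat, sesq_smul_mat, hA.sesq_comm x x₂, hB.sesq_comm x x₂,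
    Complex.normSq_apply, Complex.add_re, Complex.add_im, Complex.mul_re, Complex.mul_im,
    Complex.I_re, Complex.I_im, Complex.star_def, Complex.conj_re, Complex.conj_im, hBw]
  intro h
  have h5 : (sesq A x x₂).re * (sesq B x x₂).im = 0 := by linear_combination -h / 4
  exact (mul_ne_zero hAw hBw') h5

/-- A multiplier certificate excludes `PropertyIC`: on the null space of `Z` the certificate gives
a combination of `A₁, A₂, A₃` which is positive definite, but its values at `x₁` and `x₂` are
multiples of `x₁ᴴA₃x₁ < 0` and `x₂ᴴA₃x₂ > 0` by one and the same number. -/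
theorem not_propertyIC_of_posSemidef {A₀ A₁ A₂ A₃ : Matrix (Fin n) (Fin n) ℂ} {ν₁ ν₂ ν₃ : ℝ}
    (hpsd : (A₀ + ν₁ • A₁ + ν₂ • A₂ + ν₃ • A₃).PosSemidef) : ¬ PropertyIC A₀ A₁ A₂ A₃ := by
  rintro ⟨μ₁, μ₂, μ₃, μ₄, x₁, x₂, ⟨-, -, -, hμ₄⟩, ⟨-, hspan⟩, ⟨h11, h12, -⟩, ⟨h21, h22, -, -⟩,
    h31, h32⟩
  have key : ∀ x ∈ Submodule.span ℂ {x₁, x₂}, hermForm A₁ x = 0 → hermForm A₂ x = 0 →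
      hermForm A₃ x ≠ 0 → 0 < (ν₃ - μ₃) * hermForm A₃ x := by
    intro x hx h1 h2 h3
    have hx0 : x ≠ 0 := by rintro rfl; exact h3 (hermForm_zero _)
    have hpos := hermForm_one_pos hx0
    rw [hspan, LinearMap.mem_ker, Matrix.mulVecLin_apply] at hx
    have hZ : hermForm (A₀ + μ₁ • A₁ + μ₂ • A₂ + μ₃ • A₃ +
        μ₄ • (1 : Matrix (Fin n) (Fin n) ℂ)) x = 0 := by simp [hermForm, sesq, hx]
    have hN := (posSemidef_iff_hermForm hpsd.isHermitian).1 hpsd x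
    simp only [hermForm_add_mat, hermForm_smul_mat, h1, h2] at hZ hN
    nlinarith [mul_pos hμ₄ hpos]
  have k1 := key x₁ (Submodule.subset_span (by simp)) (by simp [hermForm, h11])
    (by simp [hermForm, h21]) h31.ne
  have k2 := key x₂ (Submodule.subset_span (by simp)) (by simp [hermForm, h12])
    (by simp [hermForm, h22]) h32.ne'
  rcases le_total 0 (ν₃ - μ₃) with h | h
  · nlinarith
  · nlinarith

theorem hermForm_lower_bound {B : Matrix (Fin n) (Fin n) ℂ} {p : ℝ}
    (h : ∀ x, hermForm 1 x = 1 → p ≤ hermForm B x) (x : Fin n → ℂ) :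
    p * hermForm 1 x ≤ hermForm B x := by
  by_cases hx : x = 0
  · simp [hx, hermForm_zero]
  · obtain ⟨r, hr, hr1, hrD⟩ := exists_normalizing hx
    have h1 := h _ (by rw [hrD, hr1])
    rw [hrD] at h1
    have h2 : r * (p * hermForm 1 x) ≤ r * hermForm B x := by
      linear_combination h1 + p * hr1
    exact le_of_mul_le_mul_left h2 hr

/-- The nontrivial implication of the S-lemma. -/
theorem exists_multipliers {A₀ A₁ A₂ A₃ : Matrix (Fin n) (Fin n) ℂ}
    (hA₀ : A₀.IsHermitian) (hA₁ : A₁.IsHermitian) (hA₂ : A₂.IsHermitian) (hA₃ : A₃.IsHermitian)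
    (hx₀ : ∃ x₀ : Fin n → ℂ, hermForm A₁ x₀ < 0 ∧ hermForm A₂ x₀ < 0 ∧ hermForm A₃ x₀ < 0)
    (hno : ¬ ∃ x : Fin n → ℂ,
      hermForm A₀ x < 0 ∧ hermForm A₁ x ≤ 0 ∧ hermForm A₂ x ≤ 0 ∧ hermForm A₃ x ≤ 0)
    (hIC : ¬ PropertyIC A₀ A₁ A₂ A₃) :
    ∃ μ₁ μ₂ μ₃ : ℝ, 0 ≤ μ₁ ∧ 0 ≤ μ₂ ∧ 0 ≤ μ₃ ∧
      (A₀ + μ₁ • A₁ + μ₂ • A₂ + μ₃ • A₃).PosSemidef := by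
  set Q : (Fin n → ℂ) → Fin 4 → ℝ :=
    fun x => ![hermForm A₀ x, hermForm A₁ x, hermForm A₂ x, hermForm A₃ x] with hQ
  have hQc : Continuous Q := continuous_pi fun i => by
    fin_cases i
    exacts [continuous_hermForm A₀, continuous_hermForm A₁, continuous_hermForm A₂,
      continuous_hermForm A₃]
  set K := Q '' {x | hermForm 1 x = 1}
  have hslater : ∃ v ∈ convexHull ℝ K, v 1 < 0 ∧ v 2 < 0 ∧ v 3 < 0 := by
    obtain ⟨x, h1, h2, h3⟩ := hx₀
    have hx : x ≠ 0 := by rintro rfl; simp [hermForm_zero] at h1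
    obtain ⟨r, hr, hr1, hrD⟩ := exists_normalizing hx
    refine ⟨_, subset_convexHull ℝ K ⟨(Real.sqrt r : ℂ) • x, (hrD 1).trans hr1, rfl⟩, ?_⟩
    simp only [hQ, hrD]
    exact ⟨mul_neg_of_pos_of_neg hr h1, mul_neg_of_pos_of_neg hr h2, mul_neg_of_pos_of_neg hr h3⟩
  obtain ⟨c, hc, μ₁, μ₂, μ₃, ⟨hc1, hc2, hc3⟩, ⟨hμ1, hμ2, hμ3⟩, hmin⟩ :=
    exists_minimizer_multipliers
      (isCompact_unit_hermForm.image hQc).convexHull_of_finiteDimensional (convex_convexHull ℝ K)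
      hslater
  set p := c 0
  have hL : (A₀ + μ₁ • A₁ + μ₂ • A₂ + μ₃ • A₃).IsHermitian :=
    ((hA₀.add (isHermitian_real_smul hA₁ _)).add (isHermitian_real_smul hA₂ _)).add
      (isHermitian_real_smul hA₃ _)
  have hLval : ∀ x, hermForm (A₀ + μ₁ • A₁ + μ₂ • A₂ + μ₃ • A₃) x =
      hermForm A₀ x + μ₁ * hermForm A₁ x + μ₂ * hermForm A₂ x + μ₃ * hermForm A₃ x := by
    intro x
    simp only [hermForm_add_mat, hermForm_smul_mat]
  have hbound := hermForm_lower_bound (B := A₀ + μ₁ • A₁ + μ₂ • A₂ + μ₃ • A₃) (p := p)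
    fun x hx => by
      rw [hLval]
      exact hmin _ (subset_convexHull ℝ K ⟨x, hx, rfl⟩)
  rcases le_or_gt 0 p with hp | hp
  · refine ⟨μ₁, μ₂, μ₃, hμ1, hμ2, hμ3, (posSemidef_iff_hermForm hL).2 fun x => ?_⟩
    refine le_trans (mul_nonneg hp ?_) (hbound x)
    by_cases hx : x = 0
    · simp [hx, hermForm_zero]
    · exact (hermForm_one_pos hx).le
  exfalso
  -- complementary slackness
  have hcc := hmin c hc
  have m1 := mul_nonpos_of_nonneg_of_nonpos hμ1 hc1
  have m2 := mul_nonpos_of_nonneg_of_nonpos hμ2 hc2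
  have m3 := mul_nonpos_of_nonneg_of_nonpos hμ3 hc3
  have s1 : μ₁ * c 1 = 0 := by linarith
  have s2 : μ₂ * c 2 = 0 := by linarith
  have s3 : μ₃ * c 3 = 0 := by linarith
  set Z := A₀ + μ₁ • A₁ + μ₂ • A₂ + μ₃ • A₃ + (-p) • (1 : Matrix (Fin n) (Fin n) ℂ) with hZ
  have hZval : ∀ x, hermForm Z x = hermForm A₀ x + μ₁ * hermForm A₁ x + μ₂ * hermForm A₂ x +
      μ₃ * hermForm A₃ x - p * hermForm 1 x := by
    intro x
    rw [hZ, hermForm_add_mat, hLval, hermForm_smul_mat]; ring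
  have hZpsd : Z.PosSemidef :=
    (posSemidef_iff_hermForm (hL.add (isHermitian_real_smul Matrix.isHermitian_one _))).2
      fun x => by
        have h1 := hZval x
        have h2 := hbound x
        rw [hLval] at h2
        linarith
  set W := LinearMap.ker (Matrix.mulVecLin Z) with hW
  have hmemW : ∀ x, x ∈ W ↔ hermForm Z x = 0 := by
    intro x
    rw [hW, LinearMap.mem_ker, Matrix.mulVecLin_apply, ← hZpsd.dotProduct_mulVec_zero_iff,
      ← hZpsd.isHermitian.sesq_self_eq_zero]
    rfl
  -- the minimiser lies in the convex hull of the part of the range coming from the null space `W`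
  have hface : ∀ {A B C : Matrix (Fin n) (Fin n) ℂ} (_ : A.IsHermitian) (_ : B.IsHermitian)
      (_ : C.IsHermitian) (f g h : (Fin 4 → ℝ) →ₗ[ℝ] ℝ) (_ : ∀ x, hermForm A x = f (Q x))
      (_ : ∀ x, hermForm B x = g (Q x)) (_ : ∀ x, hermForm C x = h (Q x)),
      ∃ z ∈ W, hermForm 1 z = 1 ∧ hermForm A z = f c ∧ hermForm B z = g c ∧
        hermForm C z ≤ h c := by
    intro A B C hA hB hC f g h hf hg hh
    set e : Fin 4 → (Fin 4 → ℝ) →ₗ[ℝ] ℝ := fun i => LinearMap.proj i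
    have hconv := convex_halfSpace_union_face (e 0 + μ₁ • e 1 + μ₂ • e 2 + μ₃ • e 3) p
      (convex_filled_range W hA hB hC f g h)
    have hsub := convexHull_min (s := K) ?_ hconv
    · rcases hsub hc with h1 | h1
      · have h2 : p < c 0 + μ₁ * c 1 + μ₂ * c 2 + μ₃ * c 3 := h1
        linarith
      · exact h1.2
    · rintro _ ⟨x, hx, rfl⟩
      have hx' : hermForm 1 x = 1 := hx
      have h1 := (posSemidef_iff_hermForm hZpsd.isHermitian).1 hZpsd x
      have h2 : (e 0 + μ₁ • e 1 + μ₂ • e 2 + μ₃ • e 3) (Q x) = hermForm Z x + p := by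
        rw [hZval, hx']
        change hermForm A₀ x + μ₁ * hermForm A₁ x + μ₂ * hermForm A₂ x + μ₃ * hermForm A₃ x = _
        ring
      rcases h1.eq_or_lt with h3 | h3
      · right
        exact ⟨by rw [h2, ← h3, zero_add], x, (hmemW x).2 h3.symm, hx', hf x, hg x, (hh x).le⟩
      · left
        change p < (e 0 + μ₁ • e 1 + μ₂ • e 2 + μ₃ • e 3) (Q x)
        linarith
  set e : Fin 4 → (Fin 4 → ℝ) →ₗ[ℝ] ℝ := fun i => LinearMap.proj i
  have e1 : ∀ x, hermForm A₁ x = e 1 (Q x) := fun _ => rfl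
  have e2 : ∀ x, hermForm A₂ x = e 2 (Q x) := fun _ => rfl
  have e3 : ∀ x, hermForm A₃ x = e 3 (Q x) := fun _ => rfl
  -- a unit vector of `W` satisfying the constraints and complementary slackness violates `hno`
  have hviol : ∀ z ∈ W, z ≠ 0 → hermForm A₁ z ≤ 0 → hermForm A₂ z ≤ 0 → hermForm A₃ z ≤ 0 →
      μ₁ * hermForm A₁ z = 0 → μ₂ * hermForm A₂ z = 0 → μ₃ * hermForm A₃ z = 0 → False := by
    intro z hz hz0 h1 h2 h3 t1 t2 t3
    refine hno ⟨z, ?_, h1, h2, h3⟩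
    have h4 := (hmemW z).1 hz
    rw [hZval] at h4
    have h5 := mul_neg_of_neg_of_pos hp (hermForm_one_pos hz0)
    linarith
  have hne : ∀ z : Fin n → ℂ, hermForm 1 z = 1 → z ≠ 0 := by
    rintro z hz rfl
    simp [hermForm_zero] at hz
  rcases hμ1.eq_or_lt with h0 | hμ1
  · obtain ⟨z, hz, hz1, k2, k3, k1⟩ := hface hA₂ hA₃ hA₁ (e 2) (e 3) (e 1) e2 e3 e1
    change _ = c 2 at k2
    change _ = c 3 at k3
    exact hviol z hz (hne z hz1) (k1.trans hc1) (k2 ▸ hc2) (k3 ▸ hc3) (by simp [← h0])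
      (k2 ▸ s2) (k3 ▸ s3)
  rcases hμ2.eq_or_lt with h0 | hμ2
  · obtain ⟨z, hz, hz1, k1, k3, k2⟩ := hface hA₁ hA₃ hA₂ (e 1) (e 3) (e 2) e1 e3 e2
    change _ = c 1 at k1
    change _ = c 3 at k3
    exact hviol z hz (hne z hz1) (k1 ▸ hc1) (k2.trans hc2) (k3 ▸ hc3) (k1 ▸ s1) (by simp [← h0])
      (k3 ▸ s3)
  rcases hμ3.eq_or_lt with h0 | hμ3
  · obtain ⟨z, hz, hz1, k1, k2, k3⟩ := hface hA₁ hA₂ hA₃ (e 1) (e 2) (e 3) e1 e2 e3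
    change _ = c 1 at k1
    change _ = c 2 at k2
    exact hviol z hz (hne z hz1) (k1 ▸ hc1) (k2 ▸ hc2) (k3.trans hc3) (k1 ▸ s1) (k2 ▸ s2)
      (by simp [← h0])
  have c1 : c 1 = 0 := (mul_eq_zero.1 s1).resolve_left hμ1.ne'
  have c2 : c 2 = 0 := (mul_eq_zero.1 s2).resolve_left hμ2.ne'
  have c3 : c 3 = 0 := (mul_eq_zero.1 s3).resolve_left hμ3.ne'
  have hno0 : ∀ z ∈ W, z ≠ 0 → hermForm A₁ z = 0 → hermForm A₂ z = 0 → hermForm A₃ z ≠ 0 :=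
    fun z hz hz0 h1 h2 h3 => hviol z hz hz0 h1.le h2.le h3.le (by simp [h1]) (by simp [h2])
      (by simp [h3])
  obtain ⟨x, hx, hx1, k1, k2, k3⟩ := hface hA₁ hA₂ hA₃ (e 1) (e 2) (e 3) e1 e2 e3
  obtain ⟨y, hy, hy1, l1, l2, l3⟩ := hface hA₁ hA₂ hA₃.neg (e 1) (e 2) (-e 3) e1 e2
    fun x => hermForm_neg_mat A₃ x
  change _ = c 1 at k1 l1
  change _ = c 2 at k2 l2
  change _ ≤ c 3 at k3
  change _ ≤ -c 3 at l3
  rw [c1] at k1 l1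
  rw [c2] at k2 l2
  rw [c3] at k3 l3
  rw [hermForm_neg_mat] at l3
  obtain ⟨x₂, hspan, q1, q2, q3⟩ := exists_span_of_no_common_zero hA₁ hA₂ hno0 hx hy k1 l1 k2 l2
    (k3.lt_of_ne (hno0 x hx (hne x hx1) k1 k2))
    ((show 0 ≤ hermForm A₃ y by linarith).lt_of_ne (hno0 y hy (hne y hy1) l1 l2).symm)
  exact hIC ⟨μ₁, μ₂, μ₃, -p, x, x₂, ⟨hμ1, hμ2, hμ3, neg_pos.2 hp⟩, ⟨hZpsd, hspan⟩, q1, q2, q3⟩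

end Main

theorem mainTheorem5 (n : ℕ) (A₀ A₁ A₂ A₃ : Matrix (Fin n) (Fin n) ℂ)
    (hA₀ : A₀.IsHermitian) (hA₁ : A₁.IsHermitian) (hA₂ : A₂.IsHermitian) (hA₃ : A₃.IsHermitian)
    (hx₀ : ∃ x₀ : Fin n → ℂ, hermForm A₁ x₀ < 0 ∧ hermForm A₂ x₀ < 0 ∧ hermForm A₃ x₀ < 0) :
    ((¬ ∃ x : Fin n → ℂ,
        hermForm A₀ x < 0 ∧ hermForm A₁ x ≤ 0 ∧ hermForm A₂ x ≤ 0 ∧ hermForm A₃ x ≤ 0) ∧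
      ¬ PropertyIC A₀ A₁ A₂ A₃) ↔
    ∃ μ₁ μ₂ μ₃ : ℝ, 0 ≤ μ₁ ∧ 0 ≤ μ₂ ∧ 0 ≤ μ₃ ∧
      (A₀ + μ₁ • A₁ + μ₂ • A₂ + μ₃ • A₃).PosSemidef := by
  refine ⟨fun ⟨hno, hIC⟩ => exists_multipliers hA₀ hA₁ hA₂ hA₃ hx₀ hno hIC, ?_⟩
  rintro ⟨μ₁, μ₂, μ₃, hμ₁, hμ₂, hμ₃, hpsd⟩
  refine ⟨?_, not_propertyIC_of_posSemidef hpsd⟩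
  rintro ⟨x, h0, h1, h2, h3⟩
  have h := (posSemidef_iff_hermForm hpsd.isHermitian).1 hpsd x
  simp only [hermForm_add_mat, hermForm_smul_mat] at h
  linarith [mul_nonpos_of_nonneg_of_nonpos hμ₁ h1, mul_nonpos_of_nonneg_of_nonpos hμ₂ h2,
    mul_nonpos_of_nonneg_of_nonpos hμ₃ h3]
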